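/- \textbf{Setting.} Let $P$ be a probability distribution on a measurable space $\mathcal Z$, let $\mathcal F$ be a class of predictors, and let $\ell_f:\mathcal Z\to\mathbb R$ ($f\in\mathcal F$) be measurable loss functions such that, for $P$-almost every $z$, $0\le \ell_f(z)\le V$ for all $f\in\mathcal F$, where $V\ge 1$ is a constant. Let $\eta^*>0$ and suppose that $(\ell,P,\mathcal F)$ satisfies the strong $\eta^*$-central condition: there is $f^*\in\mathcal F$ with $$\mathbb E_{Z\sim P}\bigl[e^{\eta^*(\ell_{f^*}(Z)-\ell_f(Z))}\bigr]\le 1\qquad\text{for all } f\in\mathcal F .$$ Suppose that the loss class $\ell\circ\mathcal F=\{\ell_f:f\in\mathcal F\}$ is separable, i.e. it has a countable subclass such that every $\ell_f$ is the pointwise limit of a sequence from that subclass. Suppose also that $\ell\circ\mathcal F$ is of VC type: there are constants $K\ge 1$ and $\mathcal C$ such that for every $\varepsilon\in(0,K]$ and every probability measure $Q$ on $\mathcal Z$, $$\mathcal N(\varepsilon,\ell\circ\mathcal F,L_2(Q))\le\Bigl(\frac{K}{\varepsilon}\Bigr)^{\mathcal C},$$ where $\mathcal N(\varepsilon,\mathcal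 G,L_2(Q))$ is the least number of $L_2(Q)$-balls of radius $\varepsilon$ with centres in $\mathcal G$ that cover $\mathcal G$. \textbf{Theorem.} Let $f^*$ be as in the central condition. For all $n\ge 5$ and $0<\delta\le\frac12$, with probability at least $1-\delta$ over an i.i.d. sample $Z_1,\dots,Z_n\sim P$, every empirical risk minimizer $\hat f\in\arg\min_{f\in\mathcal F}\frac1n\sum_{j=1}^n\ell_f(Z_j)$ satisfies $$\mathbb E_{Z\sim P}[\ell_{\hat f}(Z)]\le \mathbb E_{Z\sim P}[\ell_{f^*}(Z)]+\frac1n\max\{A_1,A_2\}+\frac1n,$$ where $$A_1=8\max\Bigl\{V,\frac1{\eta^*}\Bigr\}\Bigl(\mathcal C\log(Kn)+\log\frac2\delta\Bigr),$$ $$A_2=2V\Bigl(1080\,\mathcal C\log(2Kn)+90\sqrt{\Bigl(\log\frac2\delta\Bigr)\mathcal C\log(2Kn)}+\log\frac{2e}\delta\Bigr).$$ -/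

import Mathlib

open MeasureTheory Filter Topology
open scoped ENNReal

noncomputable section

namespace FastRates

/-- The risk `R(P, f) = E_{Z ∼ P}[ℓ_f(Z)]`. -/
def risk {Z H : Type*} [MeasurableSpace Z] (ℓ : H → Z → ℝ) (P : Measure Z) (f : H) : ℝ :=
  ∫ z, ℓ f z ∂P

/-- The empirical risk `(1/n) ∑ⱼ ℓ_f(Zⱼ)` of `f` on the sample `z = (Z₁, …, Zₙ)`. -/
def empiricalRisk {Z H : Type*} {n : ℕ} (ℓ : H → Z → ℝ) (z : Fin n → Z) (f : H) : ℝ :=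
  (1 / (n : ℝ)) * ∑ j, ℓ f (z j)

/-- `f` is an empirical risk minimizer over the model `F` on the sample `z`. -/
def IsERM {Z H : Type*} {n : ℕ} (ℓ : H → Z → ℝ) (F : Set H) (z : Fin n → Z) (f : H) : Prop :=
  f ∈ F ∧ ∀ g ∈ F, empiricalRisk ℓ z f ≤ empiricalRisk ℓ z g

/-- `fstar ∈ F` satisfies `E_{Z ∼ P}[exp(η (ℓ_{fstar}(Z) - ℓ_f(Z)))] ≤ 1` for all `f ∈ F`.
The expectation of this nonnegative variable is taken in `[0, ∞]`. -/
def IsCentralComparator {Z H : Type*} [MeasurableSpace Z] (η : ℝ) (ℓ : H → Z → ℝ)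
    (P : Measure Z) (F : Set H) (fstar : H) : Prop :=
  fstar ∈ F ∧
    ∀ f ∈ F, ∫⁻ z, ENNReal.ofReal (Real.exp (η * (ℓ fstar z - ℓ f z))) ∂P ≤ 1

/-- The strong `η`-central condition for `(ℓ, P, F)`. -/
def StrongCentralCondition {Z H : Type*} [MeasurableSpace Z] (η : ℝ) (ℓ : H → Z → ℝ)
    (P : Measure Z) (F : Set H) : Prop :=
  0 < η ∧ ∃ fstar, IsCentralComparator η ℓ P F fstar

/-- The loss class `ℓ ∘ F = {ℓ_f : f ∈ F}`. -/
def lossClass {Z H : Type*} (ℓ : H → Z → ℝ) (F : Set H) : Set (Z → ℝ) :=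
  {g | ∃ f ∈ F, g = ℓ f}

/-- A class of functions is (pointwise) separable if it has a countable subclass such that each
member of the class is the pointwise limit of a sequence from the subclass. -/
def PointwiseSeparable {Z : Type*} (G : Set (Z → ℝ)) : Prop :=
  ∃ G₀ : Set (Z → ℝ), G₀ ⊆ G ∧ G₀.Countable ∧
    ∀ g ∈ G, ∃ u : ℕ → Z → ℝ, (∀ m, u m ∈ G₀) ∧
      ∀ z, Tendsto (fun m => u m z) atTop (𝓝 (g z))

/-- The proper covering number `N(ε, G, L₂(Q))`: the least number of `L₂(Q)`-balls of radius `ε`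
with centres in `G` that cover `G` (it is `⊤` if no finite cover exists). -/
def coveringNumber {Z : Type*} [MeasurableSpace Z] (ε : ℝ) (G : Set (Z → ℝ))
    (Q : Measure Z) : ℕ∞ :=
  ⨅ (S : Set (Z → ℝ)) (_ : S ⊆ G)
    (_ : ∀ g ∈ G, ∃ s ∈ S, eLpNorm (g - s) 2 Q ≤ ENNReal.ofReal ε), S.encard

/-- `G` is of VC type with constants `K` and `C` (its universal metric entropy is at most
logarithmic): `N(ε, G, L₂(Q)) ≤ (K / ε) ^ C` for every `ε ∈ (0, K]` and every probability
measure `Q`. -/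
def IsVCType {Z : Type*} [MeasurableSpace Z] (K C : ℝ) (G : Set (Z → ℝ)) : Prop :=
  ∀ Q : Measure Z, IsProbabilityMeasure Q → ∀ ε : ℝ, 0 < ε → ε ≤ K →
    ((coveringNumber ε G Q : ℕ∞) : ℝ≥0∞) ≤ ENNReal.ofReal ((K / ε) ^ C)

end FastRates

end

namespace FastRates

/-! Cover the loss class by a finite `1/n`-net `T` in `L₂(P)`, with at most `(K n)^C` elements. Two
events suffice. First, every net element `g` whose excess risk is at least `M/n` has summed
empirical excess above a threshold `x`; this is a Chernoff bound (`measure_sum_le_le_exp`), in which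
the central condition makes the exponent linear in the excess risk, so there is no variance term and
the rate is `1/n`. Second, every loss within `1/n` of a net element in `L₂(P)` has summed truncated
distance at most `x` to it on the sample (`measure_exists_sum_gt_le`). If an empirical minimizer had
excess risk above `M/n + 1/n`, its neighbour in `T` would beat `x` against `fstar` by the first
event; by the second event it exceeds the minimizer by at most `x`, and the minimizer is no worse
than `fstar` on the sample, a contradiction.

The second event is handled by symmetrization: a ghost sample has small distance sum with
probability at least 1/2, swapping paired points preserves the law, and a cover on the `2n` points
reduces the question to counting swaps (`card_swap_le`). All functions involved are nonnegative with
mean `O(1/n)`, so exponential moments suffice and no chaining is needed. -/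

/-! ### Exponential inequalities and the count of swaps -/

/-- Once `E[exp(-y)] ≤ 1`, integration leaves `E[exp(-y/3)] ≤ 1 - (39/200) E[y]`. Both sides are
tangent at `0` whatever the constant in place of `39/200`; the endpoint `y = 1` limits it to about
`0.1978`. -/
theorem exp_neg_third_le {y : ℝ} (hy : |y| ≤ 1) :
    Real.exp (-(y / 3)) ≤
      1 + (1 / 3 - 39 / 200) * (Real.exp (-y) - 1) - 39 / 200 * y := by
  have h1 := Real.exp_bound (x := -(y / 3)) (by rw [abs_neg, abs_div]; norm_num; linarith)
    (n := 4) (by norm_num)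
  have h2 := Real.exp_bound (x := -y) (by simpa using hy) (n := 6) (by norm_num)
  have e1 : |(-(y / 3))| ^ 4 = y ^ 4 / 81 := by
    rw [abs_neg, ← abs_pow, abs_of_nonneg (by positivity)]; ring
  have e2 : |(-y)| ^ 6 = y ^ 6 := by rw [abs_neg, ← abs_pow, abs_of_nonneg (by positivity)]
  rw [e1] at h1
  rw [e2] at h2
  simp [Finset.sum_range_succ, Nat.factorial] at h1 h2
  have h1' := (abs_le.1 h1).2
  have h2' := (abs_le.1 h2).1
  obtain ⟨hl, hu⟩ := abs_le.1 hy
  -- This is the difference of the Taylor polynomials less their remainders, divided by `y ^ 2`,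
  -- with rounded coefficients.
  have hq : 0 ≤ (0.0136:ℝ) - 0.0169 * y + 0.00512 * y ^ 2 - 0.001153 * y ^ 3
      - 0.000225 * y ^ 4 := by
    have h2 : y ^ 2 ≤ 1 := by nlinarith
    have h4 : y ^ 4 ≤ y ^ 2 := by nlinarith [sq_nonneg y]
    have h3 : y ^ 3 ≤ y ^ 2 := by nlinarith [sq_nonneg y]
    nlinarith
  have hp := mul_nonneg (sq_nonneg y) hq
  have p4 : 0 ≤ y ^ 4 := by positivity
  have p6 : 0 ≤ y ^ 6 := by positivity
  have s3 : y ^ 3 ≤ y ^ 2 := by nlinarith [sq_nonneg y]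
  have s3' : -y ^ 2 ≤ y ^ 3 := by nlinarith [sq_nonneg y]
  have s5 : y ^ 5 ≤ y ^ 4 := by nlinarith [mul_nonneg p4 (sub_nonneg.2 hu)]
  have s5' : -y ^ 4 ≤ y ^ 5 := by nlinarith
  nlinarith

/-- After division by the right-hand exponential, the left side is convex in each of `a / V` and `b
/ V` separately, so only the corners of the unit square matter. The corner `(0, 0)` gives equality,
and the mixed corners use `exp(2/3) + exp(-10/3) ≤ 1.95 + 0.05`. -/
theorem exp_add_exp_le_of_mem_Icc {a b V : ℝ} (hV : 0 < V)
    (ha : a ∈ Set.Icc 0 V) (hb : b ∈ Set.Icc 0 V) :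
    Real.exp (-(4 / V * a)) + Real.exp (-(4 / V * b)) ≤ 2 * Real.exp (-(2 / 3 * ((a + b) / V))) := by
  have key : ∀ s t : ℝ, s ∈ Set.Icc (0 : ℝ) 1 → t ∈ Set.Icc (0 : ℝ) 1 →
      Real.exp (-(10 / 3) * s + 2 / 3 * t) + Real.exp (2 / 3 * s + -(10 / 3) * t) ≤ 2 := by
    have hexp : ∀ p q : ℝ, ConvexOn ℝ Set.univ (fun s : ℝ => Real.exp (p * s + q)) := by
      intro p q
      refine ConvexOn.comp_affineMap (g := AffineMap.lineMap (k := ℝ) q (p + q)) convexOn_exp |>.congr ?_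
      intro s _
      simp [AffineMap.lineMap_apply]
      ring
    have hconv : ∀ p q p' q' : ℝ, ∀ s ∈ Set.Icc (0 : ℝ) 1,
        Real.exp (p * s + q) + Real.exp (p' * s + q') ≤
          max (Real.exp q + Real.exp q') (Real.exp (p + q) + Real.exp (p' + q')) := by
      intro p q p' q' s hs
      have := ((hexp p q).add (hexp p' q')).le_max_of_mem_Icc (Set.mem_univ 0) (Set.mem_univ 1) hs
      simpa using this
    have e1 : Real.exp (2 / 3) ≤ 1.95 := by
      have := Real.exp_bound (x := 2 / 3) (by rw [abs_of_pos] <;> norm_num) (n := 6) (by norm_num)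
      rw [abs_of_pos (show (0 : ℝ) < 2 / 3 by norm_num)] at this
      have := (abs_le.1 this).2
      simp [Finset.sum_range_succ, Nat.factorial] at this
      linarith
    have e2 : Real.exp (-(10 / 3)) ≤ 0.05 := by
      rw [Real.exp_neg, inv_le_comm₀ (Real.exp_pos _) (by norm_num)]
      have := Real.sum_le_exp_of_nonneg (x := 10 / 3) (by norm_num) 6
      simp [Finset.sum_range_succ, Nat.factorial] at this
      linarith
    have e3 : Real.exp (-(10 / 3) + 2 / 3) ≤ 1 := Real.exp_le_one_iff.2 (by norm_num)
    have e4 : Real.exp (2 / 3 + -(10 / 3)) ≤ 1 := Real.exp_le_one_iff.2 (by norm_num)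
    intro s t hs ht
    refine (hconv _ _ _ _ s hs).trans (max_le ?_ ?_)
    · refine (by simpa using hconv (2 / 3) 0 (-(10 / 3)) 0 t ht : _ ≤ _).trans (max_le ?_ ?_)
      · norm_num
      · linarith
    · have := hconv (2 / 3) (-(10 / 3)) (-(10 / 3)) (2 / 3) t ht
      rw [add_comm (-(10 / 3) : ℝ) (2 / 3 * t), add_comm (2 / 3 : ℝ) (-(10 / 3) * t)]
      refine this.trans (max_le ?_ ?_)
      · linarith
      · linarith
  have hk := key (a / V) (b / V) ⟨div_nonneg ha.1 hV.le, (div_le_one hV).2 ha.2⟩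
    ⟨div_nonneg hb.1 hV.le, (div_le_one hV).2 hb.2⟩
  have hE := mul_le_mul_of_nonneg_right hk (Real.exp_pos (-(2 / 3 * ((a + b) / V)))).le
  rw [add_mul, ← Real.exp_add, ← Real.exp_add] at hE
  have f1 : -(10 / 3) * (a / V) + 2 / 3 * (b / V) + -(2 / 3 * ((a + b) / V)) = -(4 / V * a) := by
    ring
  have f2 : 2 / 3 * (a / V) + -(10 / 3) * (b / V) + -(2 / 3 * ((a + b) / V)) = -(4 / V * b) := by
    ring
  rwa [f1, f2] at hE

/-- Exponential bound on the number of sign patterns for which one half of a symmetrized sum is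
small although the whole sum is large. -/
theorem card_swap_le {n : ℕ} {V : ℝ} (hV : 1 ≤ V) (a : Bool → Fin n → ℝ)
    (ha : ∀ s i, a s i ∈ Set.Icc 0 V) (y r : ℝ) :
    (((Finset.univ.filter fun σ : Fin n → Bool =>
        y ≤ ∑ i, a (σ i) i ∧ ∑ i, a (!(σ i)) i ≤ r).card : ℕ) : ℝ) ≤
      2 ^ n * Real.exp (4 * r - 2 / 3 * (y / V)) := by
  have hV0 : 0 < V := by linarith
  set S := ∑ i, (a true i + a false i) with hS
  have hsum : ∀ σ : Fin n → Bool, ∑ i, a (σ i) i + ∑ i, a (!(σ i)) i = S := by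
    intro σ
    rw [← Finset.sum_add_distrib]
    refine Finset.sum_congr rfl fun i _ => ?_
    cases σ i
    · simp [add_comm]
    · simp
  by_cases hy : y ≤ S
  -- Markov's inequality for the uniform measure on swaps: the indicator is dominated by an
  -- exponential that factorizes over the coordinates.
  · have h1 : ∀ σ ∈ (Finset.univ.filter fun σ : Fin n → Bool =>
        y ≤ ∑ i, a (σ i) i ∧ ∑ i, a (!(σ i)) i ≤ r),
        (1 : ℝ) ≤ Real.exp (4 * r) * ∏ i, Real.exp (-(4 / V * a (!(σ i)) i)) := by
      intro σ hσ
      obtain ⟨-, -, h⟩ := Finset.mem_filter.1 hσ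
      rw [← Real.exp_sum, ← Real.exp_add]
      refine Real.one_le_exp ?_
      rw [Finset.sum_neg_distrib, ← Finset.mul_sum]
      have h0 : 0 ≤ ∑ i, a (!(σ i)) i := Finset.sum_nonneg fun i _ => (ha _ i).1
      have : 4 / V ≤ 4 := div_le_self (by norm_num) hV
      nlinarith
    have h2 : ∑ σ : Fin n → Bool, ∏ i, Real.exp (-(4 / V * a (!(σ i)) i)) =
        ∏ i, (Real.exp (-(4 / V * a true i)) + Real.exp (-(4 / V * a false i))) := by
      have := Finset.prod_univ_sum (fun _ : Fin n => (Finset.univ : Finset Bool))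
        (fun i s => Real.exp (-(4 / V * a (!s) i)))
      rw [Fintype.piFinset_univ] at this
      rw [← this]
      refine Finset.prod_congr rfl fun i _ => ?_
      simp [add_comm]
    have h3 : ∏ i, (Real.exp (-(4 / V * a true i)) + Real.exp (-(4 / V * a false i))) ≤
        2 ^ n * Real.exp (-(2 / 3 * (y / V))) := by
      calc _ ≤ ∏ i : Fin n, (2 * Real.exp (-(2 / 3 * ((a true i + a false i) / V)))) :=
            Finset.prod_le_prod (fun i _ => by positivity) fun i _ =>
              exp_add_exp_le_of_mem_Icc hV0 (ha _ i) (ha _ i)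
        _ = 2 ^ n * Real.exp (-(2 / 3 * (S / V))) := by
            rw [Finset.prod_mul_distrib, ← Real.exp_sum, Finset.sum_neg_distrib,
              ← Finset.mul_sum, ← Finset.sum_div]
            simp [hS]
        _ ≤ _ := by gcongr
    calc _ = ∑ σ ∈ (Finset.univ.filter fun σ : Fin n → Bool =>
          y ≤ ∑ i, a (σ i) i ∧ ∑ i, a (!(σ i)) i ≤ r), (1 : ℝ) := by simp
      _ ≤ ∑ σ ∈ (Finset.univ.filter fun σ : Fin n → Bool =>
          y ≤ ∑ i, a (σ i) i ∧ ∑ i, a (!(σ i)) i ≤ r),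
            Real.exp (4 * r) * ∏ i, Real.exp (-(4 / V * a (!(σ i)) i)) := Finset.sum_le_sum h1
      _ ≤ ∑ σ : Fin n → Bool, Real.exp (4 * r) * ∏ i, Real.exp (-(4 / V * a (!(σ i)) i)) :=
          Finset.sum_le_sum_of_subset_of_nonneg (Finset.filter_subset _ _)
            fun _ _ _ => by positivity
      _ ≤ Real.exp (4 * r) * (2 ^ n * Real.exp (-(2 / 3 * (y / V)))) := by
          rw [← Finset.mul_sum, h2]
          gcongr
      _ = _ := by rw [sub_eq_add_neg, Real.exp_add]; ring
  · rw [Finset.filter_false_of_mem]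
    · simp; positivity
    · intro σ _ h
      have h0 : 0 ≤ ∑ i, a (!(σ i)) i := Finset.sum_nonneg fun i _ => (ha _ i).1
      linarith [hsum σ, h.1]

/-! ### Finite covers from the entropy bound -/

theorem exists_finite_cover {Z : Type*} [MeasurableSpace Z] {K C : ℝ} {G : Set (Z → ℝ)}
    (hcov : IsVCType K C G) (Q : Measure Z) [IsProbabilityMeasure Q] {ε : ℝ}
    (hε : 0 < ε) (hεK : ε ≤ K) :
    ∃ S : Finset (Z → ℝ), ↑S ⊆ G ∧ (S.card : ℝ) ≤ (K / ε) ^ C ∧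
      ∀ g ∈ G, ∃ s ∈ S, eLpNorm (g - s) 2 Q ≤ ENNReal.ofReal ε := by
  have hpos : 0 ≤ (K / ε) ^ C := by have := hε.trans_le hεK; positivity
  have h := hcov Q inferInstance ε hε hεK
  -- Adding one to the floor gives a strict bound, so the infimum yields an actual cover;
  -- integrality of its cardinality removes the extra one.
  have hlt : coveringNumber ε G Q < (⌊(K / ε) ^ C⌋₊ + 1 : ℕ) := by
    have h2 : ((coveringNumber ε G Q : ℕ∞) : ℝ≥0∞) < ((⌊(K / ε) ^ C⌋₊ + 1 : ℕ) : ℝ≥0∞) := by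
      refine h.trans_lt ?_
      rw [← ENNReal.ofReal_natCast]
      refine (ENNReal.ofReal_lt_ofReal_iff (by positivity)).2 ?_
      push_cast
      exact Nat.lt_floor_add_one _
    exact_mod_cast h2
  simp only [coveringNumber, iInf_lt_iff] at hlt
  obtain ⟨S, hSG, hScov, hcard⟩ := hlt
  have hfin : S.Finite := Set.encard_lt_top_iff.1 (hcard.trans (ENat.natCast_lt_top _))
  refine ⟨hfin.toFinset, by simpa using hSG, ?_, fun g hg => ?_⟩
  · rw [hfin.encard_eq_coe_toFinset_card] at hcard
    have : hfin.toFinset.card < ⌊(K / ε) ^ C⌋₊ + 1 := by exact_mod_cast hcard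
    exact (Nat.cast_le.2 (Nat.lt_succ_iff.1 this)).trans (Nat.floor_le hpos)
  · simpa using hScov g hg

theorem lintegral_abs_le_of_eLpNorm_two_le {Z : Type*} [MeasurableSpace Z] (Q : Measure Z)
    [IsProbabilityMeasure Q] {h : Z → ℝ} (hm : Measurable h) {ε : ℝ}
    (hε : eLpNorm h 2 Q ≤ ENNReal.ofReal ε) :
    ∫⁻ z, ENNReal.ofReal |h z| ∂Q ≤ ENNReal.ofReal ε := by
  have := (eLpNorm_le_eLpNorm_of_exponent_le (μ := Q) (p := 1) (q := 2) (by norm_num)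
    hm.aestronglyMeasurable).trans hε
  rw [eLpNorm_one_eq_lintegral_enorm] at this
  simpa only [Real.enorm_eq_ofReal_abs] using this

/-- A cover of the class in the uniform distribution on finitely many points. -/
theorem exists_finite_cover_points {Z ι : Type*} [MeasurableSpace Z] [Fintype ι] [Nonempty ι]
    {K C : ℝ} {G : Set (Z → ℝ)} (hG : ∀ g ∈ G, Measurable g) (hK : 1 ≤ K)
    (hcov : IsVCType K C G) (p : ι → Z) :
    ∃ S : Finset (Z → ℝ), ↑S ⊆ G ∧ (S.card : ℝ) ≤ (K * Fintype.card ι) ^ C ∧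
      ∀ g ∈ G, ∃ s ∈ S, ∑ i, |g (p i) - s (p i)| ≤ 1 := by
  set N : ℝ≥0∞ := (Fintype.card ι : ℝ≥0∞) with hN
  have hN0 : N ≠ 0 := by simp [hN]
  have hNt : N ≠ ⊤ := by simp [hN]
  have hc : (1 : ℝ) ≤ Fintype.card ι := by exact_mod_cast Fintype.card_pos
  set Q : Measure Z := N⁻¹ • ∑ i, Measure.dirac (p i) with hQ
  have : IsProbabilityMeasure Q := ⟨by
    simp [hQ, ENNReal.inv_mul_cancel hN0 hNt, ← hN]⟩
  -- Radius `1/N` for `N` points makes the total, not just the average, absolute error at most 1.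
  obtain ⟨S, hS, hcard, hcover⟩ := exists_finite_cover hcov Q
    (ε := 1 / Fintype.card ι) (by positivity)
    (((div_le_one (by linarith)).2 hc).trans hK)
  refine ⟨S, hS, by simpa using hcard, fun g hg => ?_⟩
  obtain ⟨s, hs, h⟩ := hcover g hg
  refine ⟨s, hs, ?_⟩
  have hm : Measurable (g - s) := (hG g hg).sub (hG s (hS hs))
  have h1 := lintegral_abs_le_of_eLpNorm_two_le Q hm h
  rw [hQ, lintegral_smul_measure, lintegral_finsetSum_measure] at h1
  simp only [lintegral_dirac' _ (hm.abs.ennreal_ofReal), smul_eq_mul] at h1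
  rw [← ENNReal.ofReal_sum_of_nonneg (fun _ _ => abs_nonneg _), ENNReal.inv_mul_le_iff hN0 hNt,
    hN, ← ENNReal.ofReal_natCast, ← ENNReal.ofReal_mul (by positivity)] at h1
  rw [mul_one_div_cancel (by positivity)] at h1
  simpa using (ENNReal.ofReal_le_ofReal_iff zero_le_one).1 h1

/-! ### Symmetrization -/

theorem half_le_measure_sum_le {Z : Type*} [MeasurableSpace Z] (P : Measure Z)
    [IsProbabilityMeasure P] {n : ℕ} {h : Z → ℝ} (hm : Measurable h) (h0 : ∀ z, 0 ≤ h z)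
    (hint : n * ∫⁻ z, ENNReal.ofReal (h z) ∂P ≤ 2) :
    1 / 2 ≤ Measure.pi (fun _ : Fin n => P) {z | ∑ i, h (z i) ≤ 4} := by
  set μ := Measure.pi (fun _ : Fin n => P)
  have hsm : Measurable fun z : Fin n → Z => ∑ i, h (z i) :=
    Finset.measurable_sum _ fun i _ => hm.comp (measurable_pi_apply i)
  have hE : ∫⁻ z, ENNReal.ofReal (∑ i, h (z i)) ∂μ ≤ 2 := by
    simp_rw [ENNReal.ofReal_sum_of_nonneg fun (i : Fin n) _ => h0 _]
    rw [lintegral_finsetSum (μ := μ) Finset.univ (f := fun i z => ENNReal.ofReal (h (z i)))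
      fun i _ => (hm.comp (measurable_pi_apply i)).ennreal_ofReal]
    have : ∀ i : Fin n, ∫⁻ z, ENNReal.ofReal (h (z i)) ∂μ = ∫⁻ z, ENNReal.ofReal (h z) ∂P :=
      fun i => (measurePreserving_eval (fun _ : Fin n => P) i).lintegral_comp hm.ennreal_ofReal
    simpa [this] using hint
  have hM : μ {z | 4 < ∑ i, h (z i)} ≤ 1 / 2 := by
    have := mul_meas_ge_le_lintegral (μ := μ) hsm.ennreal_ofReal 4
    have h4 : (4 : ℝ≥0∞) * μ {z | 4 < ∑ i, h (z i)} ≤ 2 := by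
      refine le_trans ?_ (this.trans hE)
      refine mul_le_mul_right (measure_mono fun z hz => ?_) _
      have : ENNReal.ofReal 4 ≤ ENNReal.ofReal (∑ i, h (z i)) :=
        ENNReal.ofReal_le_ofReal (le_of_lt hz)
      simpa using this
    rw [mul_comm, ← ENNReal.le_div_iff_mul_le (by simp) (by simp)] at h4
    refine h4.trans (le_of_eq ?_)
    rw [ENNReal.div_eq_div_iff (by simp) (by simp) (by simp) (by simp)]
    norm_num
  have hc : {z : Fin n → Z | ∑ i, h (z i) ≤ 4} = {z | 4 < ∑ i, h (z i)}ᶜ := by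
    ext; simp
  rw [hc, prob_compl_eq_one_sub (measurableSet_lt measurable_const hsm)]
  calc (1 / 2 : ℝ≥0∞) = 1 - 1 / 2 := by rw [one_div, ENNReal.one_sub_inv_two]
    _ ≤ _ := tsub_le_tsub_left hM _

/-- Given a first sample and a bad `h` for it, an independent ghost sample has sum at most 4 for
that same `h` with probability at least 1/2, by Markov. Fubini then costs the factor 2. Countability
of `I` provides measurability. -/
theorem measure_exists_sum_gt_le_two_mul {Z : Type*} [MeasurableSpace Z] (P : Measure Z)
    [IsProbabilityMeasure P] {n : ℕ} {I : Set (Z → ℝ)} (hI : I.Countable)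
    (hm : ∀ h ∈ I, Measurable h) (h0 : ∀ h ∈ I, ∀ z, 0 ≤ h z)
    (hint : ∀ h ∈ I, n * ∫⁻ z, ENNReal.ofReal (h z) ∂P ≤ 2) (x : ℝ) :
    Measure.pi (fun _ : Fin n => P) {z | ∃ h ∈ I, x < ∑ i, h (z i)} ≤
      2 * Measure.pi (fun _ : Fin n => P.prod P)
        {w | ∃ h ∈ I, x < ∑ i, h (w i).1 ∧ ∑ i, h (w i).2 ≤ 4} := by
  set μ := Measure.pi (fun _ : Fin n => P)
  have hsm : ∀ h ∈ I, Measurable fun z : Fin n → Z => ∑ i, h (z i) := fun h hh =>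
    Finset.measurable_sum _ fun i _ => (hm h hh).comp (measurable_pi_apply i)
  set W : Set ((Fin n → Z) × (Fin n → Z)) :=
    {w | ∃ h ∈ I, x < ∑ i, h (w.1 i) ∧ ∑ i, h (w.2 i) ≤ 4} with hW
  have hWm : MeasurableSet W := by
    have : W = ⋃ h ∈ I, {w | x < ∑ i, h (w.1 i) ∧ ∑ i, h (w.2 i) ≤ 4} := by
      ext; simp [hW, and_left_comm]
    rw [this]
    refine MeasurableSet.biUnion hI fun h hh => ?_
    exact (measurableSet_lt measurable_const ((hsm h hh).comp measurable_fst)).inter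
      (measurableSet_le ((hsm h hh).comp measurable_snd) measurable_const)
  have hpre := (measurePreserving_arrowProdEquivProdArrow Z Z (Fin n) (fun _ => P)
    (fun _ => P)).measure_preimage hWm.nullMeasurableSet
  have hset : (MeasurableEquiv.arrowProdEquivProdArrow Z Z (Fin n)) ⁻¹' W =
      {w | ∃ h ∈ I, x < ∑ i, h (w i).1 ∧ ∑ i, h (w i).2 ≤ 4} := rfl
  rw [hset] at hpre
  rw [hpre, Measure.prod_apply hWm]
  have hBm : MeasurableSet {z : Fin n → Z | ∃ h ∈ I, x < ∑ i, h (z i)} := by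
    have : {z : Fin n → Z | ∃ h ∈ I, x < ∑ i, h (z i)} =
        ⋃ h ∈ I, {z | x < ∑ i, h (z i)} := by ext; simp
    rw [this]
    exact MeasurableSet.biUnion hI fun h hh => measurableSet_lt measurable_const (hsm h hh)
  have hlow : ∫⁻ z in {z : Fin n → Z | ∃ h ∈ I, x < ∑ i, h (z i)}, (1 / 2 : ℝ≥0∞) ∂μ ≤
      ∫⁻ z, μ (Prod.mk z ⁻¹' W) ∂μ := by
    refine le_trans (setLIntegral_mono' hBm fun z hz => ?_) (setLIntegral_le_lintegral _ _)
    obtain ⟨h, hh, hx⟩ := hz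
    refine (half_le_measure_sum_le P (hm h hh) (h0 h hh) (hint h hh)).trans (measure_mono ?_)
    intro z' hz'
    exact ⟨h, hh, hx, hz'⟩
  rw [setLIntegral_const] at hlow
  calc _ = 2 * (1 / 2 * μ {z : Fin n → Z | ∃ h ∈ I, x < ∑ i, h (z i)}) := by
        rw [← mul_assoc, one_div, ENNReal.mul_inv_cancel (by simp) (by simp), one_mul]
    _ ≤ _ := by gcongr

/-- Each coordinatewise swap preserves `(P × P)^n`, so the measure of `W` equals the integral of the
fraction of swaps that land in `W`. -/
theorem measure_le_of_card_swap_le {Z : Type*} [MeasurableSpace Z] (P : Measure Z)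
    [IsProbabilityMeasure P] {n : ℕ} {W : Set (Fin n → Z × Z)} (hW : MeasurableSet W) {q : ℝ}
    (hq : ∀ w : Fin n → Z × Z, (Nat.card {σ : Fin n → Bool |
      (fun i => if σ i then w i else (w i).swap) ∈ W} : ℝ) ≤ 2 ^ n * q) :
    Measure.pi (fun _ : Fin n => P.prod P) W ≤ ENNReal.ofReal q := by
  classical
  set ν := Measure.pi (fun _ : Fin n => P.prod P)
  let T : (Fin n → Bool) → (Fin n → Z × Z) → (Fin n → Z × Z) :=
    fun σ w i => if σ i then w i else (w i).swap
  have hT : ∀ σ, MeasurePreserving (T σ) ν ν := fun σ =>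
    measurePreserving_pi (f := fun i (p : Z × Z) => if σ i then p else p.swap) (fun _ => P.prod P)
      (fun _ => P.prod P) fun i => by
      cases σ i
      · simpa using Measure.measurePreserving_swap (μ := P) (ν := P)
      · simpa using! MeasurePreserving.id (P.prod P)
  have h1 : (2 ^ n : ℝ≥0∞) * ν W = ∑ σ : Fin n → Bool, ν (T σ ⁻¹' W) := by
    simp [fun σ => (hT σ).measure_preimage hW.nullMeasurableSet]
  have h2 : ∑ σ : Fin n → Bool, ν (T σ ⁻¹' W) ≤ ENNReal.ofReal (2 ^ n * q) := by
    calc _ = ∑ σ : Fin n → Bool, ∫⁻ w, (T σ ⁻¹' W).indicator 1 w ∂ν := by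
          refine Finset.sum_congr rfl fun σ _ => ?_
          rw [lintegral_indicator_one ((hT σ).measurable hW)]
      _ = ∫⁻ w, ∑ σ : Fin n → Bool, (T σ ⁻¹' W).indicator 1 w ∂ν := by
          rw [lintegral_finsetSum _ fun σ _ =>
            measurable_one.indicator ((hT σ).measurable hW)]
      _ ≤ ∫⁻ _, ENNReal.ofReal (2 ^ n * q) ∂ν := by
          refine lintegral_mono fun w => ?_
          refine le_trans (le_of_eq ?_) (ENNReal.ofReal_le_ofReal (hq w))
          rw [ENNReal.ofReal_natCast, Nat.card_eq_fintype_card, Fintype.card_subtype]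
          simp [Set.indicator_apply, T, Finset.sum_boole]
      _ = _ := by simp
  rw [← h1, ENNReal.ofReal_mul (by positivity)] at h2
  rw [ENNReal.ofReal_pow (by norm_num)] at h2
  simp only [ENNReal.ofReal_ofNat] at h2
  exact (ENNReal.mul_le_mul_iff_right (by simp) (by simp)).1 h2

/-- Uniform bound for sums of truncated distances `|u - g|`, `u ∈ G₀` and `g ∈ T`, in
terms of the uniform entropy. -/
theorem measure_exists_sum_gt_le {Z : Type*} [MeasurableSpace Z] (P : Measure Z)
    [IsProbabilityMeasure P] {n : ℕ} (hn : 0 < n) {K C V : ℝ} (hK : 1 ≤ K) (hV : 1 ≤ V)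
    {G G₀ : Set (Z → ℝ)} (hG : ∀ g ∈ G, Measurable g) (hcov : IsVCType K C G)
    (hG₀ : G₀ ⊆ G) (hG₀c : G₀.Countable) (T : Finset (Z → ℝ)) (hT : ↑T ⊆ G) (x : ℝ) :
    Measure.pi (fun _ : Fin n => P) {z | ∃ u ∈ G₀, ∃ g ∈ T,
        n * ∫⁻ z, ENNReal.ofReal |u z - g z| ∂P ≤ 2 ∧ x < ∑ i, min |u (z i) - g (z i)| V} ≤
      2 * ENNReal.ofReal ((2 * K * n) ^ C * T.card *
        Real.exp (20 - 2 / 3 * ((x - 1) / V))) := by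
  classical
  -- Truncation at `V` gives a bound at every point, as counting swaps requires; the losses
  -- themselves are bounded only almost everywhere.
  set I : Set (Z → ℝ) := {h | ∃ u ∈ G₀, ∃ g ∈ T,
    n * ∫⁻ z, ENNReal.ofReal |u z - g z| ∂P ≤ 2 ∧ h = fun z => min |u z - g z| V} with hI
  have hIc : I.Countable := by
    refine ((hG₀c.prod T.countable_toSet).image
      (fun p : (Z → ℝ) × (Z → ℝ) => fun z => min |p.1 z - p.2 z| V)).mono ?_
    rintro h ⟨u, hu, g, hg, -, rfl⟩
    exact ⟨(u, g), ⟨hu, hg⟩, rfl⟩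
  have hIm : ∀ h ∈ I, Measurable h := by
    rintro h ⟨u, hu, g, hg, -, rfl⟩
    exact (((hG u (hG₀ hu)).sub (hG g (hT hg))).abs).min measurable_const
  have hI0 : ∀ h ∈ I, ∀ z, 0 ≤ h z := by
    rintro h ⟨u, hu, g, hg, -, rfl⟩ z
    positivity
  have hIint : ∀ h ∈ I, n * ∫⁻ z, ENNReal.ofReal (h z) ∂P ≤ 2 := by
    rintro h ⟨u, hu, g, hg, hint, rfl⟩
    refine le_trans ?_ hint
    gcongr
    exact min_le_left _ _
  have hset : {z : Fin n → Z | ∃ u ∈ G₀, ∃ g ∈ T,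
        n * ∫⁻ z, ENNReal.ofReal |u z - g z| ∂P ≤ 2 ∧ x < ∑ i, min |u (z i) - g (z i)| V} =
      {z | ∃ h ∈ I, x < ∑ i, h (z i)} := by
    ext z
    constructor
    · rintro ⟨u, hu, g, hg, hint, hx⟩
      exact ⟨_, ⟨u, hu, g, hg, hint, rfl⟩, hx⟩
    · rintro ⟨_, ⟨u, hu, g, hg, hint, rfl⟩, hx⟩
      exact ⟨u, hu, g, hg, hint, hx⟩
  rw [hset]
  refine (measure_exists_sum_gt_le_two_mul P hIc hIm hI0 hIint x).trans ?_
  gcongr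
  have hWm : MeasurableSet {w : Fin n → Z × Z |
      ∃ h ∈ I, x < ∑ i, h (w i).1 ∧ ∑ i, h (w i).2 ≤ 4} := by
    have : {w : Fin n → Z × Z | ∃ h ∈ I, x < ∑ i, h (w i).1 ∧ ∑ i, h (w i).2 ≤ 4} =
        ⋃ h ∈ I, {w | x < ∑ i, h (w i).1 ∧ ∑ i, h (w i).2 ≤ 4} := by
      ext; simp [and_left_comm]
    rw [this]
    refine MeasurableSet.biUnion hIc fun h hh => ?_
    have := hIm h hh
    have h1 : Measurable fun w : Fin n → Z × Z => ∑ i, h (w i).1 := by fun_prop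
    have h2 : Measurable fun w : Fin n → Z × Z => ∑ i, h (w i).2 := by fun_prop
    exact (measurableSet_lt measurable_const h1).inter (measurableSet_le h2 measurable_const)
  refine measure_le_of_card_swap_le P hWm fun w => ?_
  have : Nonempty (Fin n × Bool) := ⟨(⟨0, hn⟩, true)⟩
  set p : Fin n × Bool → Z := fun k => if k.2 then (w k.1).1 else (w k.1).2 with hp
  obtain ⟨S, hSG, hScard, hScov⟩ := exists_finite_cover_points hG hK hcov p
  -- Replacing `u` by its centre `s` moves each half-sum by at most 1, hence `x - 1` and `5 = 4 +
  -- 1`. The cover `S` depends on `w` but serves all swaps at once.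
  set E : (Z → ℝ) × (Z → ℝ) → Finset (Fin n → Bool) := fun sg =>
    Finset.univ.filter fun σ => x - 1 ≤ ∑ i, min |sg.1 (p (i, σ i)) - sg.2 (p (i, σ i))| V ∧
      ∑ i, min |sg.1 (p (i, !(σ i))) - sg.2 (p (i, !(σ i)))| V ≤ 5 with hE
  have hEcard : ∀ sg, ((E sg).card : ℝ) ≤
      2 ^ n * Real.exp (20 - 2 / 3 * ((x - 1) / V)) := by
    intro sg
    have := card_swap_le hV (fun b i => min |sg.1 (p (i, b)) - sg.2 (p (i, b))| V)
      (fun b i => ⟨by positivity, min_le_right _ _⟩) (x - 1) 5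
    rwa [show (4 : ℝ) * 5 = 20 by norm_num] at this
  have hsub : {σ : Fin n → Bool | (fun i => if σ i then w i else (w i).swap) ∈
      {w : Fin n → Z × Z | ∃ h ∈ I, x < ∑ i, h (w i).1 ∧ ∑ i, h (w i).2 ≤ 4}} ⊆
      ↑((S ×ˢ T).biUnion E) := by
    rintro σ ⟨h, ⟨u, hu, g, hg, -, rfl⟩, h1, h2⟩
    obtain ⟨s, hs, hsu⟩ := hScov u (hG₀ hu)
    have hclose : ∀ τ : Fin n → Bool, ∑ i, |u (p (i, τ i)) - s (p (i, τ i))| ≤ 1 := by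
      intro τ
      refine le_trans ?_ hsu
      rw [Fintype.sum_prod_type]
      refine Finset.sum_le_sum fun i _ => ?_
      exact Finset.single_le_sum (f := fun b => |u (p (i, b)) - s (p (i, b))|)
        (fun _ _ => abs_nonneg _) (Finset.mem_univ (τ i))
    have hmin : ∀ z, |min |u z - g z| V - min |s z - g z| V| ≤ |u z - s z| := by
      intro z
      refine (abs_min_sub_min_le_max _ _ _ _).trans ?_
      rw [sub_self, abs_zero, max_eq_left (abs_nonneg _)]
      refine (abs_abs_sub_abs_le _ _).trans (le_of_eq ?_)
      congr 1
      ring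
    have e1 : ∀ i, ((if σ i then w i else (w i).swap) : Z × Z).1 = p (i, σ i) := by
      intro i; simp only [hp]; cases σ i <;> simp
    have e2 : ∀ i, ((if σ i then w i else (w i).swap) : Z × Z).2 = p (i, !(σ i)) := by
      intro i; simp only [hp]; cases σ i <;> simp
    simp only [e1, e2] at h1 h2
    have hdiff : ∀ τ : Fin n → Bool, |∑ i, min |u (p (i, τ i)) - g (p (i, τ i))| V -
        ∑ i, min |s (p (i, τ i)) - g (p (i, τ i))| V| ≤ 1 := by
      intro τ
      rw [← Finset.sum_sub_distrib]
      exact (Finset.abs_sum_le_sum_abs _ _).trans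
        ((Finset.sum_le_sum fun i _ => hmin _).trans (hclose τ))
    have d1 := abs_le.1 (hdiff σ)
    have d2 := abs_le.1 (hdiff fun i => !(σ i))
    simp only [Finset.coe_biUnion, Set.mem_iUnion]
    refine ⟨(s, g), by simpa using ⟨hs, hg⟩, ?_⟩
    simp only [hE, Finset.coe_filter, Finset.mem_univ, true_and, Set.mem_ofPred_eq]
    constructor <;> linarith [d1.1, d1.2, d2.1, d2.2]
  have hcard : (Nat.card {σ : Fin n → Bool | (fun i => if σ i then w i else (w i).swap) ∈
      {w : Fin n → Z × Z | ∃ h ∈ I, x < ∑ i, h (w i).1 ∧ ∑ i, h (w i).2 ≤ 4}} : ℝ) ≤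
      (((S ×ˢ T).biUnion E).card : ℝ) := by
    rw [Nat.card_coe_set_eq, ← Set.ncard_coe_finset]
    exact_mod_cast Set.ncard_le_ncard hsub (Finset.finite_toSet _)
  refine hcard.trans ?_
  calc (((S ×ˢ T).biUnion E).card : ℝ) ≤ ∑ sg ∈ S ×ˢ T, ((E sg).card : ℝ) := by
        exact_mod_cast Finset.card_biUnion_le
    _ ≤ ∑ sg ∈ S ×ˢ T, 2 ^ n * Real.exp (20 - 2 / 3 * ((x - 1) / V)) :=
        Finset.sum_le_sum fun sg _ => hEcard sg
    _ = S.card * (2 ^ n * (T.card * Real.exp (20 - 2 / 3 * ((x - 1) / V)))) := by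
        rw [Finset.sum_const, Finset.card_product, nsmul_eq_mul]
        push_cast
        ring
    _ ≤ (2 * K * n) ^ C * (2 ^ n * (T.card * Real.exp (20 - 2 / 3 * ((x - 1) / V)))) := by
        gcongr
        refine hScard.trans (le_of_eq ?_)
        congr 1
        simp
        ring
    _ = _ := by ring

/-! ### Chernoff bound under the central condition -/

theorem integral_exp_neg_le {Z : Type*} [MeasurableSpace Z] (P : Measure Z)
    [IsProbabilityMeasure P] {X : Z → ℝ} (hX : Measurable X) {η s V : ℝ}
    (hb : ∀ᵐ z ∂P, |X z| ≤ V) (hs : 0 < s) (hsη : s ≤ η) (hsV : s * V ≤ 1)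
    (hc : ∫⁻ z, ENNReal.ofReal (Real.exp (-(η * X z))) ∂P ≤ 1) :
    ∫ z, Real.exp (-(s / 3 * X z)) ∂P ≤ Real.exp (-(39 / 200 * s * ∫ z, X z ∂P)) := by
  have hη : 0 < η := hs.trans_le hsη
  have hint : ∀ c : ℝ, Integrable (fun z => Real.exp (-(c * X z))) P := by
    intro c
    refine Integrable.of_bound (C := Real.exp (|c| * V)) (by fun_prop) ?_
    filter_upwards [hb] with z hz
    rw [Real.norm_eq_abs, abs_of_pos (Real.exp_pos _)]
    refine Real.exp_le_exp.2 ((neg_le_abs _).trans ?_)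
    rw [abs_mul]
    gcongr
  have hXi : Integrable X P := by
    refine Integrable.of_bound (C := V) hX.aestronglyMeasurable ?_
    simpa [Real.norm_eq_abs] using hb
  have hη1 : ∫ z, Real.exp (-(η * X z)) ∂P ≤ 1 := by
    rw [integral_eq_lintegral_of_nonneg_ae (ae_of_all _ fun z => (Real.exp_pos _).le)
      (hint η).aestronglyMeasurable]
    exact ENNReal.toReal_le_of_le_ofReal zero_le_one (by simpa using hc)
  have hs1 : ∫ z, Real.exp (-(s * X z)) ∂P ≤ 1 := by
    -- Bernoulli's inequality with power `s / η ≤ 1` carries the central condition from `η` down to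
    -- `s`.
    have hpt : ∀ z, Real.exp (-(s * X z)) ≤ 1 + s / η * (Real.exp (-(η * X z)) - 1) := by
      intro z
      have := rpow_one_add_le_one_add_mul_self (s := Real.exp (-(η * X z)) - 1)
        (p := s / η) (by linarith [Real.exp_pos (-(η * X z))]) (by positivity)
        ((div_le_one hη).2 hsη)
      rw [add_sub_cancel, ← Real.exp_mul] at this
      convert this using 2
      field_simp
    have i0 : Integrable (fun z => s / η * (Real.exp (-(η * X z)) - 1)) P :=
      ((hint η).sub (integrable_const _)).const_mul _
    calc _ ≤ ∫ z, (1 + s / η * (Real.exp (-(η * X z)) - 1)) ∂P :=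
          integral_mono (hint s) ((integrable_const _).add i0) hpt
      _ = 1 + s / η * (∫ z, Real.exp (-(η * X z)) ∂P - 1) := by
          rw [integral_add (integrable_const _) i0,
            integral_const_mul, integral_sub (hint η) (integrable_const _)]
          simp
      _ ≤ 1 := by
          have : s / η * (∫ z, Real.exp (-(η * X z)) ∂P - 1) ≤ 0 :=
            mul_nonpos_of_nonneg_of_nonpos (by positivity) (by linarith)
          linarith
  have i1 : Integrable (fun z => (1 / 3 - 39 / 200) * (Real.exp (-(s * X z)) - 1)) P :=
    ((hint s).sub (integrable_const _)).const_mul _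
  have i2 : Integrable (fun z => 1 + (1 / 3 - 39 / 200) * (Real.exp (-(s * X z)) - 1)) P :=
    (integrable_const _).add i1
  have hpt : ∀ᵐ z ∂P, Real.exp (-(s / 3 * X z)) ≤
      1 + (1 / 3 - 39 / 200) * (Real.exp (-(s * X z)) - 1) - 39 / 200 * s * X z := by
    filter_upwards [hb] with z hz
    have hy : |s * X z| ≤ 1 := by
      rw [abs_mul, abs_of_pos hs]
      exact (mul_le_mul_of_nonneg_left hz hs.le).trans hsV
    have := exp_neg_third_le hy
    convert this using 2 <;> ring
  calc _ ≤ ∫ z, (1 + (1 / 3 - 39 / 200) * (Real.exp (-(s * X z)) - 1) -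
          39 / 200 * s * X z) ∂P :=
        integral_mono_ae (hint _) (i2.sub (hXi.const_mul _)) hpt
    _ = 1 + (1 / 3 - 39 / 200) * (∫ z, Real.exp (-(s * X z)) ∂P - 1) -
          39 / 200 * s * ∫ z, X z ∂P := by
        rw [integral_sub i2 (hXi.const_mul _),
          integral_add (integrable_const _) i1, integral_const_mul, integral_const_mul,
          integral_sub (hint s) (integrable_const _)]
        simp
    _ ≤ -(39 / 200 * s * ∫ z, X z ∂P) + 1 := by linarith
    _ ≤ _ := Real.add_one_le_exp _

theorem measure_sum_le_le_exp {Z : Type*} [MeasurableSpace Z] (P : Measure Z)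
    [IsProbabilityMeasure P] {X : Z → ℝ} (hX : Measurable X) {η s V : ℝ}
    (hb : ∀ᵐ z ∂P, |X z| ≤ V) (hs : 0 < s) (hsη : s ≤ η) (hsV : s * V ≤ 1)
    (hc : ∫⁻ z, ENNReal.ofReal (Real.exp (-(η * X z))) ∂P ≤ 1) (n : ℕ) (x : ℝ) :
    Measure.pi (fun _ : Fin n => P) {z | ∑ i, X (z i) ≤ x} ≤
      ENNReal.ofReal (Real.exp (s / 3 * x - 39 / 200 * s * (n * ∫ z, X z ∂P))) := by
  set μ := Measure.pi (fun _ : Fin n => P)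
  have hint : Integrable (fun z => Real.exp (-(s / 3 * X z))) P := by
    refine Integrable.of_bound (C := Real.exp (s / 3 * V)) (by fun_prop) ?_
    filter_upwards [hb] with z hz
    rw [Real.norm_eq_abs, abs_of_pos (Real.exp_pos _)]
    refine Real.exp_le_exp.2 ?_
    rw [← mul_neg]
    have := (neg_le_abs _).trans hz
    gcongr
  have hpi : Integrable (fun z : Fin n → Z => ∏ i, Real.exp (-(s / 3 * X (z i)))) μ :=
    Integrable.fintype_prod (f := fun _ : Fin n => fun z => Real.exp (-(s / 3 * X z)))
      fun _ => hint
  have hM := mul_meas_ge_le_integral_of_nonneg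
    (ae_of_all μ fun z => Finset.prod_nonneg fun i _ => (Real.exp_pos _).le) hpi
    (Real.exp (-(s / 3 * x)))
  rw [integral_fintype_prod_eq_pow (fun z => Real.exp (-(s / 3 * X z))), Fintype.card_fin] at hM
  have hpow : (∫ z, Real.exp (-(s / 3 * X z)) ∂P) ^ n ≤
      Real.exp (-(39 / 200 * s * (n * ∫ z, X z ∂P))) := by
    refine (pow_le_pow_left₀ (integral_nonneg fun z => (Real.exp_pos _).le)
      (integral_exp_neg_le P hX hb hs hsη hsV hc) n).trans (le_of_eq ?_)
    rw [← Real.exp_nat_mul]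
    congr 1
    ring
  have hsub : {z : Fin n → Z | ∑ i, X (z i) ≤ x} ⊆
      {z | Real.exp (-(s / 3 * x)) ≤ ∏ i, Real.exp (-(s / 3 * X (z i)))} := by
    intro z hz
    change Real.exp (-(s / 3 * x)) ≤ ∏ i, Real.exp (-(s / 3 * X (z i)))
    rw [← Real.exp_sum, Finset.sum_neg_distrib, ← Finset.mul_sum]
    have : ∑ i, X (z i) ≤ x := hz
    gcongr
  rw [← ofReal_measureReal]
  refine ENNReal.ofReal_le_ofReal ?_
  have h2 : Real.exp (-(s / 3 * x)) * μ.real {z : Fin n → Z | ∑ i, X (z i) ≤ x} ≤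
      Real.exp (-(39 / 200 * s * (n * ∫ z, X z ∂P))) := by
    refine le_trans ?_ (hM.trans hpow)
    gcongr
    exact measure_ne_top μ _
  rw [sub_eq_add_neg, Real.exp_add]
  calc _ = Real.exp (s / 3 * x) *
        (Real.exp (-(s / 3 * x)) * μ.real {z : Fin n → Z | ∑ i, X (z i) ≤ x}) := by
        rw [← mul_assoc, ← Real.exp_add, add_neg_cancel, Real.exp_zero, one_mul]
    _ ≤ _ := by gcongr

/-! ### Risk comparison, numerical exponent and limits -/

theorem integral_sub_integral_le {Z : Type*} [MeasurableSpace Z] (P : Measure Z)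
    [IsProbabilityMeasure P] {g h : Z → ℝ} (hg : Measurable g) (hh : Measurable h)
    (hgi : Integrable g P) (hhi : Integrable h P) {ε : ℝ} (hε : 0 ≤ ε)
    (hgh : eLpNorm (g - h) 2 P ≤ ENNReal.ofReal ε) :
    |∫ z, g z ∂P - ∫ z, h z ∂P| ≤ ε := by
  rw [← integral_sub hgi hhi]
  refine (abs_integral_le_integral_abs).trans ?_
  rw [integral_eq_lintegral_of_nonneg_ae (ae_of_all _ fun z => abs_nonneg _)
    (by fun_prop)]
  exact ENNReal.toReal_le_of_le_ofReal hε
    (lintegral_abs_le_of_eLpNorm_two_le P (hg.sub hh) hgh)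

/-- At radius `K / 2` a cover of a nonempty class has at least one element, while the bound is `2 ^
C`. -/
theorem IsVCType.exponent_nonneg {Z : Type*} [MeasurableSpace Z] (P : Measure Z)
    [IsProbabilityMeasure P] {K C : ℝ} {G : Set (Z → ℝ)} (hK : 1 ≤ K) (hG : G.Nonempty)
    (hcov : IsVCType K C G) : 0 ≤ C := by
  obtain ⟨S, -, hcard, hS⟩ := exists_finite_cover hcov P (ε := K / 2) (by linarith) (by linarith)
  obtain ⟨g, hg⟩ := hG
  obtain ⟨s, hs, -⟩ := hS g hg
  have h1 : (1 : ℝ) ≤ S.card := by exact_mod_cast Finset.card_pos.2 ⟨s, hs⟩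
  have h2 : K / (K / 2) = 2 := by field_simp
  rw [h2] at hcard
  by_contra hC
  have := Real.rpow_lt_one_of_one_lt_of_neg (by norm_num : (1 : ℝ) < 2) (not_le.1 hC)
  linarith

/-- The exponent in the union bound is at most `-(E + D)`. -/
theorem exponent_le {V V' s D E Λ M : ℝ} (hV : 1 ≤ V) (hVV' : V ≤ V') (hs : s = 1 / V')
    (hD : 0 ≤ D) (hE : 0 ≤ E) (hΛ : Real.log 2 ≤ Λ) (h1 : 8 * V' * (E + D) ≤ M)
    (h2 : 2 * V * (1080 * Λ + D) ≤ M) {m : ℝ} (hm : M ≤ m) :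
    s / 3 * (1 + 3 / 2 * V * (2 * Λ + D + 21)) - 39 / 200 * s * m ≤ -(E + D) := by
  have hV' : 0 < V' := by linarith
  have hΛ' : 0.69 ≤ Λ := by linarith [Real.log_two_gt_d9]
  -- For instance `0.185 * h1 + 0.01 * h2` works: the first pays for `V' * (E + D)` and nearly all
  -- of `V * D / 2`, the second for the rest, with `Λ ≥ log 2` absorbing the constants.
  have key : 1 / 3 * (1 + 3 / 2 * V * (2 * Λ + D + 21)) + V' * (E + D) ≤ 39 / 200 * m := by
    have a1 : V * D ≤ V' * D := by gcongr
    have a2 : 0 ≤ V' * E := by positivity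
    have a3 : 0 ≤ V * (Λ - 0.69) := mul_nonneg (by linarith) (by linarith)
    have a4 : 0 ≤ V * D := mul_nonneg (by linarith) hD
    nlinarith
  have : s * (1 / 3 * (1 + 3 / 2 * V * (2 * Λ + D + 21)) + V' * (E + D)) ≤ s * (39 / 200 * m) := by
    have : 0 < s := by rw [hs]; positivity
    gcongr
  have hsV : s * V' = 1 := by rw [hs]; field_simp
  linear_combination this + (-(E + D)) * hsV

/-- A class with a trivial cover at scale `1 / (2n)` has risks within `1 / n` of each other. -/
theorem integral_sub_le_of_log_lt {Z : Type*} [MeasurableSpace Z] (P : Measure Z)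
    [IsProbabilityMeasure P] {K C : ℝ} {G : Set (Z → ℝ)} (hK : 1 ≤ K)
    (hG : ∀ g ∈ G, Measurable g) (hGi : ∀ g ∈ G, Integrable g P) (hcov : IsVCType K C G)
    {n : ℕ} (hn : 0 < n) (hΛ : C * Real.log (2 * K * n) < Real.log 2) {g h : Z → ℝ}
    (hg : g ∈ G) (hh : h ∈ G) : ∫ z, g z ∂P ≤ ∫ z, h z ∂P + 1 / n := by
  have hn' : (1 : ℝ) ≤ n := by exact_mod_cast hn
  have hεK : 1 / (2 * (n : ℝ)) ≤ K := by
    refine le_trans ?_ hK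
    rw [div_le_one (by positivity)]
    linarith
  obtain ⟨S, hSG, hcard, hS⟩ := exists_finite_cover hcov P (ε := 1 / (2 * (n : ℝ)))
    (by positivity) hεK
  have hKn : K / (1 / (2 * (n : ℝ))) = 2 * K * n := by field_simp
  rw [hKn, Real.rpow_def_of_pos (by positivity), mul_comm] at hcard
  have h2 : (S.card : ℝ) < 2 := by
    refine hcard.trans_lt ?_
    exact (Real.exp_lt_exp.2 hΛ).trans_eq (Real.exp_log two_pos)
  have h1 : S.card ≤ 1 := by
    have : S.card < 2 := by exact_mod_cast h2
    omega
  obtain ⟨s, hs, hgs⟩ := hS g hg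
  obtain ⟨s', hs', hhs⟩ := hS h hh
  obtain rfl := Finset.card_le_one.1 h1 s hs s' hs'
  have b1 := abs_le.1 (integral_sub_integral_le P (hG g hg) (hG s (hSG hs)) (hGi g hg)
    (hGi s (hSG hs)) (by positivity) hgs)
  have b2 := abs_le.1 (integral_sub_integral_le P (hG h hh) (hG s (hSG hs)) (hGi h hh)
    (hGi s (hSG hs)) (by positivity) hhs)
  have : 1 / (2 * (n : ℝ)) + 1 / (2 * (n : ℝ)) = 1 / n := by field_simp; norm_num
  linarith [b1.2, b2.1]

/-- Passage from a countable subclass to the class by pointwise limits. -/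
theorem sum_abs_sub_le_of_tendsto {Z : Type*} [MeasurableSpace Z] (P : Measure Z)
    [IsProbabilityMeasure P] {V : ℝ} {n : ℕ} (hn : 0 < n) {u : ℕ → Z → ℝ} {f g : Z → ℝ}
    (hu : ∀ m, Measurable (u m)) (hg : Measurable g)
    (hlim : ∀ z, Tendsto (fun m => u m z) atTop (𝓝 (f z)))
    (hb : ∀ m, ∀ᵐ z ∂P, |u m z - g z| ≤ V)
    (hfg : ∫⁻ z, ENNReal.ofReal |f z - g z| ∂P ≤ ENNReal.ofReal (1 / n)) {x : ℝ} (z : Fin n → Z)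
    (hz : ∀ m, n * ∫⁻ z, ENNReal.ofReal |u m z - g z| ∂P ≤ 2 →
      ∑ i, min |u m (z i) - g (z i)| V ≤ x) :
    ∑ i, min |f (z i) - g (z i)| V ≤ x := by
  have hn' : (0 : ℝ) < n := by exact_mod_cast hn
  have hT : Tendsto (fun m => ∫⁻ z, ENNReal.ofReal |u m z - g z| ∂P) atTop
      (𝓝 (∫⁻ z, ENNReal.ofReal |f z - g z| ∂P)) := by
    refine tendsto_lintegral_of_dominated_convergence (fun _ => ENNReal.ofReal V)
      (fun m => ((hu m).sub hg).abs.ennreal_ofReal) (fun m => ?_) (by simp)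
      (ae_of_all _ fun z => ?_)
    · filter_upwards [hb m] with z hz
      exact ENNReal.ofReal_le_ofReal hz
    · exact ENNReal.tendsto_ofReal ((hlim z).sub_const _).abs
  -- The gap between `1/n` and `2/n` lets the approximants `u m` qualify eventually.
  have hlt : ∫⁻ z, ENNReal.ofReal |f z - g z| ∂P < ENNReal.ofReal (2 / n) :=
    hfg.trans_lt ((ENNReal.ofReal_lt_ofReal_iff (by positivity)).2 (by gcongr; norm_num))
  have hev : ∀ᶠ m in atTop, ∑ i, min |u m (z i) - g (z i)| V ≤ x := by
    filter_upwards [hT.eventually_lt_const hlt] with m hm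
    refine hz m ?_
    calc _ ≤ (n : ℝ≥0∞) * ENNReal.ofReal (2 / n) := by gcongr
      _ = 2 := by
        rw [← ENNReal.ofReal_natCast, ← ENNReal.ofReal_mul hn'.le, mul_div_cancel₀ _ hn'.ne']
        simp
  refine le_of_tendsto ?_ hev
  exact tendsto_finsetSum _ fun i _ => (((hlim (z i)).sub_const _).abs).min tendsto_const_nhds

/-- A set of outer measure at most `δ` is avoided by a measurable set of measure at least
`1 - δ`. -/
theorem exists_measurableSet_of_measure_le {Ω : Type*} [MeasurableSpace Ω] (μ : Measure Ω)
    [IsProbabilityMeasure μ] {B : Set Ω} {δ : ℝ} (hδ : 0 ≤ δ) (hB : μ B ≤ ENNReal.ofReal δ) :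
    ∃ A : Set Ω, MeasurableSet A ∧ ENNReal.ofReal (1 - δ) ≤ μ A ∧ ∀ z ∈ A, z ∉ B := by
  refine ⟨(toMeasurable μ B)ᶜ, (measurableSet_toMeasurable _ _).compl, ?_,
    fun z hz hzB => hz (subset_toMeasurable μ B hzB)⟩
  rw [prob_compl_eq_one_sub (measurableSet_toMeasurable _ _), measure_toMeasurable,
    ENNReal.ofReal_sub _ hδ, ENNReal.ofReal_one]
  exact tsub_le_tsub_left hB _

end FastRates

/-! ### Proof of the risk bound -/

theorem mainTheorem7 {Z H : Type*} [MeasurableSpace Z]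
    (P : Measure Z) [IsProbabilityMeasure P]
    (ℓ : H → Z → ℝ) (F : Set H) (hmeas : ∀ f ∈ F, Measurable (ℓ f))
    (ηstar : ℝ) (hcentral : FastRates.StrongCentralCondition ηstar ℓ P F)
    (hsep : FastRates.PointwiseSeparable (FastRates.lossClass ℓ F))
    (K C : ℝ) (hK : 1 ≤ K) (hcov : FastRates.IsVCType K C (FastRates.lossClass ℓ F))
    (V : ℝ) (hV : 1 ≤ V) (hbdd : ∀ᵐ z ∂P, ∀ f ∈ F, 0 ≤ ℓ f z ∧ ℓ f z ≤ V)
    (n : ℕ) (hn : 5 ≤ n) (δ : ℝ) (hδ : 0 < δ) (hδ' : δ ≤ 1 / 2)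
    (fstar : H) (hfstar : FastRates.IsCentralComparator ηstar ℓ P F fstar) :
    ∃ A : Set (Fin n → Z), MeasurableSet A ∧
      ENNReal.ofReal (1 - δ) ≤ Measure.pi (fun _ : Fin n => P) A ∧
      ∀ z ∈ A, ∀ fhat : H, FastRates.IsERM ℓ F z fhat →
        FastRates.risk ℓ P fhat ≤ FastRates.risk ℓ P fstar
          + (1 / (n : ℝ)) *
            max (8 * max V (1 / ηstar) * (C * Real.log (K * n) + Real.log (2 / δ)))
              (2 * V * (1080 * C * Real.log (2 * K * n)
                + 90 * Real.sqrt (Real.log (2 / δ) * C * Real.log (2 * K * n))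
                + Real.log (2 * Real.exp 1 / δ)))
          + 1 / (n : ℝ) := by
  classical
  set G := FastRates.lossClass ℓ F with hGdef
  have hmem : ∀ f ∈ F, ℓ f ∈ G := fun f hf => ⟨f, hf, rfl⟩
  have hG : ∀ g ∈ G, Measurable g := by rintro _ ⟨f, hf, rfl⟩; exact hmeas f hf
  have hGb : ∀ᵐ z ∂P, ∀ g ∈ G, 0 ≤ g z ∧ g z ≤ V := by
    filter_upwards [hbdd] with z hz
    rintro _ ⟨f, hf, rfl⟩
    exact hz f hf
  have hGi : ∀ g ∈ G, Integrable g P := by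
    intro g hg
    refine Integrable.of_bound (C := V) (hG g hg).aestronglyMeasurable ?_
    filter_upwards [hGb] with z hz
    rw [Real.norm_eq_abs, abs_of_nonneg (hz g hg).1]
    exact (hz g hg).2
  have hGd : ∀ᵐ z ∂P, ∀ g ∈ G, ∀ h ∈ G, |g z - h z| ≤ V := by
    filter_upwards [hGb] with z hz g hg h hh
    rw [abs_le]
    constructor <;> linarith [(hz g hg).1, (hz g hg).2, (hz h hh).1, (hz h hh).2]
  have hfs := hmem fstar hfstar.1
  have hC : 0 ≤ C := FastRates.IsVCType.exponent_nonneg P hK ⟨_, hfs⟩ hcov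
  have hη : 0 < ηstar := hcentral.1
  have hn0 : 0 < n := by omega
  have hn1 : (1 : ℝ) ≤ n := by exact_mod_cast hn0
  have hnp : (0 : ℝ) < n := by linarith
  have hKn1 : 1 ≤ K * n := one_le_mul_of_one_le_of_one_le hK hn1
  have hKn2 : K * n ≤ 2 * K * n := by nlinarith
  set Λ := C * Real.log (2 * K * n) with hΛdef
  set E := C * Real.log (K * n) with hEdef
  set D := Real.log (2 / δ) with hDdef
  set V' := max V (1 / ηstar) with hV'def
  have hE0 : 0 ≤ E := mul_nonneg hC (Real.log_nonneg hKn1)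
  have hEΛ : E ≤ Λ := mul_le_mul_of_nonneg_left (Real.log_le_log (by linarith) hKn2) hC
  have hD0 : 0 ≤ D := Real.log_nonneg (by rw [le_div_iff₀ hδ]; linarith)
  have hexpD : Real.exp (-D) = δ / 2 := by
    rw [Real.exp_neg, hDdef, Real.exp_log (by positivity), inv_div]
  have hVV' : V ≤ V' := le_max_left _ _
  have hV'0 : 0 < V' := by linarith
  set M := max (8 * V' * (E + D)) (2 * V * (1080 * C * Real.log (2 * K * n)
    + 90 * Real.sqrt (D * C * Real.log (2 * K * n)) + Real.log (2 * Real.exp 1 / δ))) with hMdef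
  have hM1 : 8 * V' * (E + D) ≤ M := le_max_left _ _
  -- The square root and the 1 in `log (2e/δ) = D + 1` are simply discarded.
  have hM2 : 2 * V * (1080 * Λ + D) ≤ M := by
    refine le_trans ?_ (le_max_right _ _)
    have h1 : Real.log (2 * Real.exp 1 / δ) = D + 1 := by
      rw [mul_div_right_comm, Real.log_mul (by positivity) (Real.exp_pos _).ne', Real.log_exp]
    have h2 := Real.sqrt_nonneg (D * C * Real.log (2 * K * n))
    have h3 : 1080 * C * Real.log (2 * K * n) = 1080 * Λ := by rw [hΛdef]; ring
    rw [h1, h3]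
    exact mul_le_mul_of_nonneg_left (by linarith) (by linarith)
  have hM0 : 0 ≤ M := le_trans (by positivity) hM1
  -- When `Λ < log 2` one ball covers the class and the final `1/n` suffices; otherwise `Λ`
  -- dominates the numerical constants.
  rcases lt_or_ge Λ (Real.log 2) with hΛ | hΛ
  · refine ⟨Set.univ, MeasurableSet.univ, ?_, fun z _ fhat hf => ?_⟩
    · rw [measure_univ]
      exact ENNReal.ofReal_le_one.2 (by linarith)
    · have := FastRates.integral_sub_le_of_log_lt P hK hG hGi hcov hn0 hΛ (hmem _ hf.1) hfs
      have h0 : 0 ≤ 1 / (n : ℝ) * M := by positivity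
      simp only [FastRates.risk]
      linarith
  obtain ⟨T, hTG, hTcard, hTcov⟩ := FastRates.exists_finite_cover hcov P (ε := 1 / (n : ℝ))
    (by positivity) (((div_le_one hnp).2 hn1).trans hK)
  have hTE : (T.card : ℝ) ≤ Real.exp E := by
    refine hTcard.trans (le_of_eq ?_)
    rw [div_div_eq_mul_div, div_one, Real.rpow_def_of_pos (by positivity), mul_comm]
  obtain ⟨G₀, hG₀G, hG₀c, hG₀⟩ := hsep
  -- Chosen so that the exponent in `measure_exists_sum_gt_le` is `-2Λ - D - 1`: `2Λ` pays for the
  -- two covers, `D` for the confidence, and the 1 for the factor 2, since `2 ≤ e`.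
  set x : ℝ := 1 + 3 / 2 * V * (2 * Λ + D + 21) with hx
  set μ := Measure.pi (fun _ : Fin n => P) with hμ
  set s : ℝ := 1 / V' with hs
  have hs0 : 0 < s := by positivity
  have hsη : s ≤ ηstar := by
    rw [hs, div_le_comm₀ hV'0 hη]
    exact le_max_right _ _
  have hsV : s * V ≤ 1 := by
    rw [hs, one_div_mul_eq_div, div_le_one hV'0]
    exact hVV'
  set T' := T.filter fun g => M ≤ n * ∫ z, (g z - ℓ fstar z) ∂P with hT'
  -- Outside this null set the truncation at `V` has no effect. It need not be measurable, so its
  -- outer measure is used.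
  set B₀ : Set (Fin n → Z) := {z | ¬ ∀ i, ∀ g ∈ G, ∀ h ∈ G, |g (z i) - h (z i)| ≤ V}
  set B₁ : Set (Fin n → Z) := ⋃ g ∈ T', {z | ∑ i, (g (z i) - ℓ fstar (z i)) ≤ x}
  set B₂ : Set (Fin n → Z) := {z | ∃ u ∈ G₀, ∃ g ∈ T,
    n * ∫⁻ z, ENNReal.ofReal |u z - g z| ∂P ≤ 2 ∧ x < ∑ i, min |u (z i) - g (z i)| V}
  have hB₀ : μ B₀ = 0 := by
    have : ∀ᵐ z ∂μ, ∀ i, ∀ g ∈ G, ∀ h ∈ G, |g (z i) - h (z i)| ≤ V :=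
      ae_all_iff.2 fun i =>
        (measurePreserving_eval (fun _ : Fin n => P) i).quasiMeasurePreserving.ae hGd
    exact this
  have hB₁ : μ B₁ ≤ ENNReal.ofReal (δ / 2) := by
    have hg : ∀ g ∈ T', μ {z | ∑ i, (g (z i) - ℓ fstar (z i)) ≤ x} ≤
        ENNReal.ofReal (Real.exp (-(E + D))) := by
      intro g hgT'
      obtain ⟨hgT, hgM⟩ := Finset.mem_filter.1 hgT'
      obtain ⟨f, hf, rfl⟩ := hTG hgT
      have hcf : ∫⁻ z, ENNReal.ofReal (Real.exp (-(ηstar * (ℓ f z - ℓ fstar z)))) ∂P ≤ 1 := by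
        simpa only [← mul_neg, neg_sub] using hfstar.2 f hf
      refine (FastRates.measure_sum_le_le_exp P ((hmeas f hf).sub (hG _ hfs)) (V := V)
        (by filter_upwards [hGd] with z hz using hz _ (hmem f hf) _ hfs)
        hs0 hsη hsV hcf n x).trans ?_
      exact ENNReal.ofReal_le_ofReal (Real.exp_le_exp.2
        (FastRates.exponent_le hV hVV' hs hD0 hE0 hΛ hM1 hM2 hgM))
    calc μ B₁ ≤ ∑ g ∈ T', μ {z | ∑ i, (g (z i) - ℓ fstar (z i)) ≤ x} :=
          measure_biUnion_finset_le _ _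
      _ ≤ ∑ g ∈ T', ENNReal.ofReal (Real.exp (-(E + D))) := Finset.sum_le_sum hg
      _ = ENNReal.ofReal (T'.card * Real.exp (-(E + D))) := by
          rw [Finset.sum_const, nsmul_eq_mul, ENNReal.ofReal_mul (by positivity),
            ENNReal.ofReal_natCast]
      _ ≤ ENNReal.ofReal (Real.exp E * Real.exp (-(E + D))) := by
          gcongr
          exact le_trans (by exact_mod_cast Finset.card_filter_le _ _) hTE
      _ = _ := by
          rw [← Real.exp_add, ← hexpD]
          congr 2
          ring
  have hB₂ : μ B₂ ≤ ENNReal.ofReal (δ / 2) := by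
    refine (FastRates.measure_exists_sum_gt_le P hn0 hK hV hG hcov hG₀G hG₀c T hTG x).trans ?_
    have h2 : (2 : ℝ≥0∞) = ENNReal.ofReal 2 := by simp
    rw [h2, ← ENNReal.ofReal_mul (by norm_num)]
    refine ENNReal.ofReal_le_ofReal ?_
    have e1 : (2 * K * n) ^ C = Real.exp Λ := by
      rw [Real.rpow_def_of_pos (by positivity), mul_comm]
    have e2 : 20 - 2 / 3 * ((x - 1) / V) = -(2 * Λ) - D - 1 := by
      rw [hx]
      field_simp
      ring
    rw [e1, e2]
    calc 2 * (Real.exp Λ * T.card * Real.exp (-(2 * Λ) - D - 1))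
        ≤ 2 * (Real.exp Λ * Real.exp Λ * Real.exp (-(2 * Λ) - D - 1)) := by
          gcongr
          exact hTE.trans (Real.exp_le_exp.2 hEΛ)
      _ = 2 * Real.exp (-1) * Real.exp (-D) := by
          rw [← Real.exp_add, ← Real.exp_add, mul_assoc, ← Real.exp_add]
          congr 2
          ring
      _ ≤ 1 * Real.exp (-D) := by
          gcongr
          rw [Real.exp_neg, ← div_eq_mul_inv, div_le_one (Real.exp_pos _)]
          linarith [Real.exp_one_gt_d9]
      _ = δ / 2 := by rw [one_mul, hexpD]
  have hB : μ (B₀ ∪ B₁ ∪ B₂) ≤ ENNReal.ofReal δ := by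
    calc _ ≤ μ B₀ + μ B₁ + μ B₂ :=
          (measure_union_le _ _).trans (add_le_add_left (measure_union_le _ _) _)
      _ ≤ 0 + ENNReal.ofReal (δ / 2) + ENNReal.ofReal (δ / 2) := by
          rw [hB₀]
          gcongr
      _ = _ := by
          rw [zero_add, ← ENNReal.ofReal_add (by positivity) (by positivity), add_halves]
  obtain ⟨A, hA, hAμ, hAB⟩ := FastRates.exists_measurableSet_of_measure_le μ hδ.le hB
  refine ⟨A, hA, hAμ, fun z hz fhat hf => ?_⟩
  have hzB := hAB z hz
  simp only [Set.mem_union, not_or] at hzB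
  obtain ⟨⟨hz₀, hz₁⟩, hz₂⟩ := hzB
  have hz₀ : ∀ i, ∀ g ∈ G, ∀ h ∈ G, |g (z i) - h (z i)| ≤ V := not_not.1 hz₀
  by_contra hcon
  have hcon := not_le.1 hcon
  have hfG := hmem _ hf.1
  obtain ⟨g, hgT, hgf⟩ := hTcov _ hfG
  have hgG := hTG hgT
  have hclose := abs_le.1 (FastRates.integral_sub_integral_le P (hG _ hfG) (hG g hgG) (hGi _ hfG)
    (hGi g hgG) (by positivity) hgf)
  have hgT' : g ∈ T' := by
    refine Finset.mem_filter.2 ⟨hgT, ?_⟩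
    rw [integral_sub (hGi g hgG) (hGi _ hfs)]
    simp only [FastRates.risk] at hcon
    have : 1 / (n : ℝ) * M ≤ ∫ z, g z ∂P - ∫ z, ℓ fstar z ∂P := by linarith [hclose.2]
    rwa [one_div_mul_eq_div, div_le_iff₀' hnp] at this
  have h1 : x < ∑ i, (g (z i) - ℓ fstar (z i)) := by
    by_contra h
    exact hz₁ (Set.mem_biUnion hgT' (not_lt.1 h))
  have h2 : ∑ i, ℓ fhat (z i) ≤ ∑ i, ℓ fstar (z i) := by
    have := hf.2 fstar hfstar.1
    simp only [FastRates.empiricalRisk] at this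
    exact le_of_mul_le_mul_left this (by positivity)
  -- `B₂` concerns only the countable subclass, so its bound must reach the minimizer's loss through
  -- a pointwise limit.
  obtain ⟨u, hu, hlim⟩ := hG₀ _ hfG
  have h3 : ∑ i, min |ℓ fhat (z i) - g (z i)| V ≤ x := by
    refine FastRates.sum_abs_sub_le_of_tendsto P hn0 (fun m => hG _ (hG₀G (hu m))) (hG g hgG) hlim
      (fun m => by filter_upwards [hGd] with z hz using hz _ (hG₀G (hu m)) g hgG)
      (FastRates.lintegral_abs_le_of_eLpNorm_two_le P ((hG _ hfG).sub (hG g hgG)) hgf) z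
      fun m hm => ?_
    by_contra h
    exact hz₂ ⟨u m, hu m, g, hgT, hm, not_le.1 h⟩
  have h4 : ∑ i, (g (z i) - ℓ fhat (z i)) ≤ ∑ i, min |ℓ fhat (z i) - g (z i)| V := by
    refine Finset.sum_le_sum fun i _ => ?_
    rw [min_eq_left (hz₀ i _ hfG g hgG), abs_sub_comm]
    exact le_abs_self _
  rw [Finset.sum_sub_distrib] at h1 h4
  linarith
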